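/- For real $\alpha\in(1,2)$, integers $k\ge 3$ and $r\ge 1$, and real $x\ge 1$, let \[ L_{\alpha,k,r}(x)=\min\bigl\{\,y\ge 0 : \text{there is an integer } n\in[x,x+y] \text{ such that } (\lfloor (n+rj)^\alpha\rfloor)_{j=0}^{k-1} \text{ is an arithmetic progression of length } k\,\bigr\}, \] where $y$ ranges over the real numbers and an arithmetic progression of length $k$ is a strictly increasing sequence $(a_j)_{j=0}^{k-1}$ of positive integers such that $a_{j+1}-a_j$ is the same for all $0\le j\le k-2$. Then this minimum exists for every $x\ge 1$, and for all $\alpha\in(1,2)$ and all integers $k\ge3$ and $r\ge1$ we have \[ L_{\alpha,k,r}(x)=O_{\alpha,k,r}(x^{2-\alpha})\qquad (x\to\infty), \] that is, there are constants $C>0$ and $x_0\ge 1$ depending only on $\alpha,k,r$ such that $L_{\alpha,k,r}(x)\le C\,x^{2-\alpha}$ for all real $x\ge x_0$. -/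

import Mathlib

open Filter

/-- The terms `a 0, …, a (k - 1)` form an arithmetic progression of length `k`: a strictly
increasing sequence of positive integers whose first differences are constant. -/
structure IsAP (k : ℕ) (a : ℕ → ℤ) : Prop where
  pos : ∀ j, j < k → 0 < a j
  lt : ∀ i j, i < j → j < k → a i < a j
  const_diff : ∃ q : ℤ, ∀ j, j + 1 < k → a (j + 1) - a j = q

/-- The set of all `y ≥ 0` such that the interval `[x, x + y]` contains an integer `n` for which
`(⌊(n + r j) ^ α⌋)`, `j = 0, …, k - 1`, is an arithmetic progression of length `k`. -/
def lengthSet (α : ℝ) (k r : ℕ) (x : ℝ) : Set ℝ :=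
  {y : ℝ | 0 ≤ y ∧ ∃ n : ℤ, x ≤ (n : ℝ) ∧ (n : ℝ) ≤ x + y ∧
    IsAP k (fun j => ⌊((n : ℝ) + (r : ℝ) * (j : ℝ)) ^ α⌋)}

/-- The minimum length `L_{α,k,r}(x)`. It is the minimum of `lengthSet α k r x` whenever that
minimum exists. -/
noncomputable def minLength (α : ℝ) (k r : ℕ) (x : ℝ) : ℝ :=
  sInf (lengthSet α k r x)

/-! Put `g t = r α t^(α-1)`. Its slope near `x` is of order `B ≍ x^(α-2)`, so `g t` is an integer
`m` for some `t` within `O(x^(2-α))` of `x`. From `p = ⌈t⌉` on, `F i = (p + r i)^α - m i` has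
increments of order at least `B r i`: nonnegative, small, yet summing to 1 after about `x^((2-α)/2)`
steps. So `F` crosses an integer slowly, and the next `k` values share a floor
(`exists_floor_const_of_increments`). Adding back `m i` gives a progression of difference `m`.
Reaching `t` is the dominant cost. -/

/-- A real sequence with small nonnegative increments that grows by at least one has `k`
consecutive terms with the same integer part. -/
theorem exists_floor_const_of_increments {F : ℕ → ℝ} {N k : ℕ} (hk : 1 ≤ k)
    (hmono : ∀ i < N + k, F i ≤ F (i + 1)) (hstep : ∀ i < N + k, F (i + 1) - F i ≤ 1 / k)
    (hgrow : F 0 + 1 ≤ F N) :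
    ∃ i ≤ N, ∃ M : ℤ, ∀ j < k, ⌊F (i + j)⌋ = M := by
  classical
  have hk' : (0 : ℝ) < k := by exact_mod_cast hk
  set M : ℤ := ⌊F 0⌋ + 1 with hM
  have hF0 : F 0 < M := by rw [hM]; push_cast; exact Int.lt_floor_add_one _
  have hex : ∃ i, (M : ℝ) ≤ F i :=
    ⟨N, by rw [hM]; push_cast; linarith [Int.floor_le (F 0)]⟩
  have hN : (M : ℝ) ≤ F N := by rw [hM]; push_cast; linarith [Int.floor_le (F 0)]
  -- The value before the first crossing is below `M`, so the overshoot is at most `1 / k`.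
  obtain ⟨i, hi⟩ : ∃ i, i = Nat.find hex := ⟨_, rfl⟩
  have hiN : i ≤ N := hi ▸ Nat.find_min' hex hN
  have hMi : (M : ℝ) ≤ F i := hi ▸ Nat.find_spec hex
  have hi0 : i ≠ 0 := by rintro rfl; linarith
  obtain ⟨l, rfl⟩ := Nat.exists_eq_succ_of_ne_zero hi0
  have hl : F l < M := not_le.mp (Nat.find_min hex (by omega))
  refine ⟨l + 1, hiN, M, fun j hj => ?_⟩
  have key : ∀ j < k, (M : ℝ) ≤ F (l + 1 + j) ∧ F (l + 1 + j) < M + (j + 1) / k := by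
    intro j
    induction j with
    | zero =>
      intro _
      have := hstep l (by omega)
      simp only [Nat.cast_zero, zero_add, add_zero]
      exact ⟨hMi, by linarith⟩
    | succ j ih =>
      intro hj
      obtain ⟨h1, h2⟩ := ih (by omega)
      have h3 := hmono (l + 1 + j) (by omega)
      have h4 := hstep (l + 1 + j) (by omega)
      rw [← add_assoc]
      refine ⟨by linarith, ?_⟩
      push_cast
      have : ((j : ℝ) + 1 + 1) / k = (j + 1) / k + 1 / k := by ring
      linarith
  obtain ⟨h1, h2⟩ := key j hj
  refine Int.floor_eq_iff.mpr ⟨h1, h2.trans_le ?_⟩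
  have : ((j : ℝ) + 1) / k ≤ 1 := by
    rw [div_le_one hk']
    exact_mod_cast hj
  linarith

/-- Two-sided bounds for the increments of `t ↦ t ^ (α - 1)` on `[x, 2 * x]`. -/
theorem rpow_sub_one_increment_bounds {α x u v : ℝ} (hα₁ : 1 < α) (hα₂ : α < 2) (hx : 0 < x)
    (hu : x ≤ u) (huv : u ≤ v) (hv : v ≤ 2 * x) :
    (α - 1) / 2 * x ^ (α - 2) * (v - u) ≤ v ^ (α - 1) - u ^ (α - 1) ∧
      v ^ (α - 1) - u ^ (α - 1) ≤ (α - 1) * x ^ (α - 2) * (v - u) := by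
  rcases huv.eq_or_lt with rfl | huv
  · simp
  have hd : ∀ t : ℝ, 0 < t → HasDerivAt (fun t : ℝ => t ^ (α - 1)) ((α - 1) * t ^ (α - 2)) t := by
    intro t ht
    convert Real.hasDerivAt_rpow_const (p := α - 1) (Or.inl ht.ne') using 3
    ring
  obtain ⟨ξ, ⟨h1, h2⟩, h3⟩ := exists_hasDerivAt_eq_slope (fun t : ℝ => t ^ (α - 1)) _ huv
    (fun t ht => (hd t (by linarith [ht.1])).continuousAt.continuousWithinAt)
    (fun t ht => hd t (by linarith [ht.1]))
  rw [eq_div_iff (by linarith)] at h3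
  rw [← h3]
  have hup : ξ ^ (α - 2) ≤ x ^ (α - 2) :=
    Real.rpow_le_rpow_of_nonpos hx (by linarith) (by linarith)
  -- The factor `1 / 2` comes from `ξ ≤ 2 x` and `α - 2 > -1`.
  have hlow : 1 / 2 * x ^ (α - 2) ≤ ξ ^ (α - 2) := by
    calc 1 / 2 * x ^ (α - 2) ≤ (2 : ℝ) ^ (α - 2) * x ^ (α - 2) := by
          gcongr
          calc (1 / 2 : ℝ) = (2 : ℝ) ^ (-1 : ℝ) := by rw [Real.rpow_neg_one]; norm_num
            _ ≤ _ := Real.rpow_le_rpow_of_exponent_le (by norm_num) (by linarith)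
      _ = (2 * x) ^ (α - 2) := (Real.mul_rpow (by norm_num) hx.le).symm
      _ ≤ _ := Real.rpow_le_rpow_of_nonpos (by linarith) (by linarith) (by linarith)
  have hα : 0 ≤ α - 1 := by linarith
  have hw : 0 ≤ v - u := by linarith
  constructor
  · refine mul_le_mul_of_nonneg_right ?_ hw
    nlinarith
  · exact mul_le_mul_of_nonneg_right (mul_le_mul_of_nonneg_left hup hα) hw

/-- The increments of `t ↦ t ^ α` lie between the values of its derivative at the end points. -/
theorem rpow_increment_bounds {α u v : ℝ} (hα₁ : 1 < α) (hu : 0 < u) (huv : u ≤ v) :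
    α * u ^ (α - 1) * (v - u) ≤ v ^ α - u ^ α ∧ v ^ α - u ^ α ≤ α * v ^ (α - 1) * (v - u) := by
  rcases huv.eq_or_lt with rfl | huv
  · simp
  have hd : ∀ t : ℝ, 0 < t → HasDerivAt (fun t : ℝ => t ^ α) (α * t ^ (α - 1)) t :=
    fun t ht => Real.hasDerivAt_rpow_const (Or.inl ht.ne')
  obtain ⟨ξ, ⟨h1, h2⟩, h3⟩ := exists_hasDerivAt_eq_slope (fun t : ℝ => t ^ α) _ huv
    (fun t ht => (hd t (by linarith [ht.1])).continuousAt.continuousWithinAt)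
    (fun t ht => hd t (by linarith [ht.1]))
  rw [eq_div_iff (by linarith)] at h3
  rw [← h3]
  have hw : 0 ≤ v - u := by linarith
  have hα : 0 ≤ α - 1 := by linarith
  have hξ : 0 ≤ ξ := by linarith
  constructor <;> gcongr

/-- Equal integer parts of `(n + r j) ^ α - m j`, `j < k`, give an arithmetic progression. -/
theorem isAP_of_floor_sub_eq {α : ℝ} (hα : 0 < α) {k r : ℕ} {n m M : ℤ} (hn : 1 ≤ n)
    (hm : 1 ≤ m)
    (h : ∀ j < k, ⌊((n : ℝ) + (r : ℝ) * (j : ℝ)) ^ α - m * j⌋ = M) :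
    IsAP k (fun j => ⌊((n : ℝ) + (r : ℝ) * (j : ℝ)) ^ α⌋) := by
  have h' : ∀ j < k, ⌊((n : ℝ) + (r : ℝ) * (j : ℝ)) ^ α⌋ = M + m * j := by
    intro j hj
    have := h j hj
    rw [show (m : ℝ) * j = ((m * j : ℤ) : ℝ) by push_cast; rfl, Int.floor_sub_intCast] at this
    linarith
  have hn' : (1 : ℝ) ≤ n := by exact_mod_cast hn
  refine ⟨fun j _ => ?_, fun i j hij hj => ?_, m, fun j hj => ?_⟩
  · refine Int.floor_pos.mpr (Real.one_le_rpow ?_ hα.le)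
    have : (0 : ℝ) ≤ (r : ℝ) * j := by positivity
    linarith
  · simp only [h' j hj, h' i (hij.trans hj)]
    have : (i : ℤ) < j := by exact_mod_cast hij
    nlinarith
  · simp only [h' (j + 1) hj, h' j (by omega)]
    push_cast
    ring

/-- The core construction, with the size conditions on `x` made explicit: `I` steps of length `r`
beyond a point where `r α t ^ (α - 1)` is an integer suffice. -/
theorem exists_isAP_of_large {α : ℝ} (hα₁ : 1 < α) (hα₂ : α < 2) {k r I : ℕ} (hk : 1 ≤ k)
    (hr : 1 ≤ r) {x B R : ℝ} (hx : 1 ≤ x) (hB : B = r * α * (α - 1) * x ^ (α - 2))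
    (hR : R = 2 / B + 1 + r * (2 * I + k)) (hRx : R ≤ x)
    (hI : 2 ≤ B * r * I ^ 2) (hsmall : B * (1 + r * (2 * I + k)) ≤ 1 / k) :
    ∃ n : ℤ, x ≤ n ∧ (n : ℝ) ≤ x + R ∧
      IsAP k (fun j => ⌊((n : ℝ) + (r : ℝ) * (j : ℝ)) ^ α⌋) := by
  have hx0 : 0 < x := by linarith
  have hr' : (1 : ℝ) ≤ r := by exact_mod_cast hr
  have hr0 : (0 : ℝ) < r := by linarith
  have hα0 : 0 < α := by linarith
  have hBpos : 0 < B := by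
    rw [hB]
    have : 0 < α - 1 := by linarith
    positivity
  obtain ⟨g, hg⟩ : ∃ g : ℝ → ℝ, g = fun t => r * α * t ^ (α - 1) := ⟨_, rfl⟩
  have hgb : ∀ u v, x ≤ u → u ≤ v → v ≤ 2 * x →
      B / 2 * (v - u) ≤ g v - g u ∧ g v - g u ≤ B * (v - u) := by
    intro u v hu huv hv
    obtain ⟨h1, h2⟩ := rpow_sub_one_increment_bounds hα₁ hα₂ hx0 hu huv hv
    have hc : 0 ≤ r * α := by positivity
    have h1' := mul_le_mul_of_nonneg_left h1 hc
    have h2' := mul_le_mul_of_nonneg_left h2 hc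
    rw [hg, hB]
    constructor <;> linarith
  have hRpos : 0 ≤ 1 + (r : ℝ) * (2 * I + k) := by positivity
  have h2B : 0 < 2 / B := by positivity
  -- a point where the scaled derivative is an integer
  obtain ⟨t, ht, hgt⟩ : ∃ t ∈ Set.Icc x (x + 2 / B), g t = (⌈g x⌉ : ℤ) := by
    have hcont : ContinuousOn g (Set.Icc x (x + 2 / B)) := by
      rw [hg]
      exact continuousOn_const.mul
        (continuousOn_id.rpow_const fun t _ => Or.inr (by linarith))
    refine intermediate_value_Icc (by linarith) hcont ⟨Int.le_ceil _, ?_⟩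
    have h1 := (hgb x (x + 2 / B) le_rfl (by linarith) (by linarith)).1
    -- At slope at least `B / 2`, length `2 / B` lets `g` gain 1.
    have h2 : B / 2 * (x + 2 / B - x) = 1 := by field_simp; ring
    linarith [Int.ceil_lt_add_one (g x)]
  obtain ⟨m, hm⟩ : ∃ m : ℤ, m = ⌈g x⌉ := ⟨_, rfl⟩
  rw [← hm] at hgt
  have hm1 : 1 ≤ m := by
    rw [hm]
    refine Int.one_le_ceil_iff.mpr ?_
    rw [hg]
    positivity
  obtain ⟨p, hp⟩ : ∃ p : ℤ, p = ⌈t⌉ := ⟨_, rfl⟩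
  have htp : t ≤ p := hp ▸ Int.le_ceil t
  have hpt : (p : ℝ) < t + 1 := hp ▸ Int.ceil_lt_add_one t
  obtain ⟨F, hF⟩ : ∃ F : ℕ → ℝ, F = fun i : ℕ => ((p : ℝ) + r * i) ^ α - m * i := ⟨_, rfl⟩
  have hstep : ∀ i : ℕ, g (p + r * i) - m ≤ F (i + 1) - F i ∧
      F (i + 1) - F i ≤ g (p + r * (i + 1)) - m := by
    intro i
    have hpi : 0 < (p : ℝ) + r * i := by
      have : (0 : ℝ) ≤ r * i := by positivity
      linarith [ht.1]
    obtain ⟨h1, h2⟩ := rpow_increment_bounds hα₁ hpi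
      (show (p : ℝ) + r * i ≤ p + r * (i + 1) by linarith)
    rw [hF, hg]
    push_cast
    constructor <;> linarith
  have hpos : ∀ i : ℕ, i ≤ 2 * I + k → t ≤ (p : ℝ) + r * i ∧ (p : ℝ) + r * i ≤ 2 * x ∧
      (p : ℝ) + r * i - t ≤ 1 + r * (2 * I + k) := by
    intro i hi
    have hi' : (i : ℝ) ≤ 2 * I + k := by exact_mod_cast hi
    have h0 : (0 : ℝ) ≤ r * i := by positivity
    have h1 := mul_le_mul_of_nonneg_left hi' hr0.le
    exact ⟨by linarith, by linarith [ht.2], by linarith⟩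
  -- Since `m = g t`, the bounds in `hstep` are increments of `g` from `t`; the lower one uses `t ≤
  -- p`.
  have hincr : ∀ i < 2 * I + k, B / 2 * (r * i) ≤ F (i + 1) - F i ∧
      F (i + 1) - F i ≤ 1 / k := by
    intro i hi
    obtain ⟨h1, h2⟩ := hstep i
    obtain ⟨a1, a2, a3⟩ := hpos i (by omega)
    obtain ⟨b1, b2, b3⟩ := hpos (i + 1) (by omega)
    push_cast at b1 b2 b3
    have h3 := (hgb t _ ht.1 a1 a2).1
    have h4 := (hgb t _ ht.1 b1 b2).2
    have h5 := mul_le_mul_of_nonneg_left b3 hBpos.le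
    have h6 : B / 2 * (r * i) ≤ B / 2 * (p + r * i - t) := by
      gcongr
      linarith
    constructor <;> linarith
  have hmono : ∀ i < 2 * I + k, F i ≤ F (i + 1) := by
    intro i hi
    have h1 := (hincr i hi).1
    have : 0 ≤ B / 2 * (r * i) := by positivity
    linarith
  have hgrow1 : ∀ i ≤ I, F 0 ≤ F i := by
    intro i
    induction i with
    | zero => exact fun _ => le_rfl
    | succ i ih => exact fun hi => (ih (by omega)).trans (hmono i (by omega))
  -- Each of the last `I` steps gains at least `B r I / 2`, in total `B r I² / 2 ≥ 1`.
  have hgrow2 : ∀ i ≤ I, F I + B / 2 * (r * I) * i ≤ F (I + i) := by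
    intro i
    induction i with
    | zero => simp
    | succ i ih =>
      intro hi
      have h1 := ih (by omega)
      have h2 := (hincr (I + i) (by omega)).1
      have h3 : B / 2 * (r * I) ≤ B / 2 * (r * ((I + i : ℕ) : ℝ)) := by
        gcongr
        omega
      rw [← add_assoc]
      push_cast at h2 h3 ⊢
      linarith
  have hgrow : F 0 + 1 ≤ F (2 * I) := by
    have h1 := hgrow1 I le_rfl
    have h2 := hgrow2 I le_rfl
    rw [← two_mul] at h2
    have h3 : B / 2 * (r * I) * I = B * r * I ^ 2 / 2 := by ring
    linarith
  obtain ⟨i, hi, M, hM⟩ :=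
    exists_floor_const_of_increments hk hmono (fun i hi => (hincr i hi).2) hgrow
  obtain ⟨a1, -, a3⟩ := hpos i (by omega)
  refine ⟨p + r * i, ?_, ?_, ?_⟩
  · push_cast
    linarith [ht.1]
  · push_cast
    linarith [ht.2]
  · refine isAP_of_floor_sub_eq (m := m) (M := M + m * i) hα0 ?_ hm1 fun j hj => ?_
    · have : (1 : ℝ) ≤ ((p + r * i : ℤ) : ℝ) := by
        push_cast
        linarith [ht.1]
      exact_mod_cast this
    · rw [← hM j hj, hF, ← Int.floor_add_intCast]
      push_cast
      congr 1
      rw [show (p : ℝ) + r * i + r * j = p + r * (i + j) by ring]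
      ring

/-- For large `x` a window of length `O(x ^ (2 - α))` contains a suitable integer. -/
theorem exists_isAP_short_interval {α : ℝ} (hα₁ : 1 < α) (hα₂ : α < 2) {k r : ℕ} (hk : 1 ≤ k)
    (hr : 1 ≤ r) :
    ∃ C : ℝ, ∀ᶠ x : ℝ in atTop, ∃ n : ℤ, x ≤ n ∧ (n : ℝ) ≤ x + C * x ^ (2 - α) ∧
      IsAP k (fun j => ⌊((n : ℝ) + (r : ℝ) * (j : ℝ)) ^ α⌋) := by
  have hr' : (1 : ℝ) ≤ r := by exact_mod_cast hr
  have hr0 : (0 : ℝ) < r := by linarith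
  have hk0 : (0 : ℝ) < k := by exact_mod_cast hk
  obtain ⟨A, hA⟩ : ∃ A : ℝ, A = r * α * (α - 1) := ⟨_, rfl⟩
  have hApos : 0 < A := by
    rw [hA]
    have : 0 < α - 1 := by linarith
    positivity
  -- The summand 1 forces `K ≤ K ^ 2`, used for `hKA`.
  obtain ⟨K, hK⟩ : ∃ K : ℝ, K = 2 / (A * r) + 1 := ⟨_, rfl⟩
  have hK1 : 1 ≤ K := by rw [hK]; have : 0 ≤ 2 / (A * r) := by positivity
                         linarith
  have hKA : 2 ≤ A * r * K ^ 2 := by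
    have h1 : 2 ≤ A * r * K := by
      rw [hK, mul_add, mul_div_cancel₀ _ (by positivity)]
      have : 0 < A * r := by positivity
      linarith
    have h2 : A * r * K ≤ A * r * K ^ 2 := by
      gcongr
      nlinarith
    linarith
  obtain ⟨D, hD⟩ : ∃ D : ℝ, D = 1 + r * (2 * (K + 1) + k) := ⟨_, rfl⟩
  have hDpos : 0 < D := by
    rw [hD]
    positivity
  -- Square-root scale: `y = x ^ b` has `y ^ 2 = x ^ (2 - α)`, and `I ≈ K y` steps are taken.
  obtain ⟨b, hb⟩ : ∃ b : ℝ, b = (2 - α) / 2 := ⟨_, rfl⟩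
  have hb0 : 0 < b := by rw [hb]; linarith
  refine ⟨2 / A + D, ?_⟩
  -- `hev1` keeps the window inside `[x, 2 x]`; `hev2` makes the increments at most `1 / k`.
  have hev1 : ∀ᶠ x : ℝ in atTop, 2 / A + D ≤ x ^ (α - 1) :=
    (tendsto_rpow_atTop (by linarith)).eventually_ge_atTop _
  have hev2 : ∀ᶠ x : ℝ in atTop, A * D * k ≤ x ^ b :=
    (tendsto_rpow_atTop hb0).eventually_ge_atTop _
  filter_upwards [hev1, hev2, eventually_ge_atTop 1] with x h1 h2 hx
  have hx0 : 0 < x := by linarith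
  obtain ⟨y, hy⟩ : ∃ y : ℝ, y = x ^ b := ⟨_, rfl⟩
  rw [← hy] at h2
  have hy1 : 1 ≤ y := hy ▸ Real.one_le_rpow hx hb0.le
  have hy0 : 0 < y := by linarith
  have hyy : x ^ (2 - α) = y ^ 2 := by
    rw [hy, ← Real.rpow_natCast, ← Real.rpow_mul hx0.le, hb]
    congr 1
    push_cast
    ring
  have hyi : x ^ (α - 2) = (y ^ 2)⁻¹ := by
    rw [← hyy, ← Real.rpow_neg hx0.le]
    congr 1
    ring
  obtain ⟨I, hI⟩ : ∃ I : ℕ, I = ⌈K * y⌉₊ := ⟨_, rfl⟩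
  have hI1 : K * y ≤ I := hI ▸ Nat.le_ceil _
  have hI2 : (I : ℝ) < K * y + 1 := hI ▸ Nat.ceil_lt_add_one (by positivity)
  have hDy : 1 + (r : ℝ) * (2 * I + k) ≤ D * y := by
    have h3 : 2 * (I : ℝ) + k ≤ (2 * (K + 1) + k) * y := by nlinarith
    have h4 := mul_le_mul_of_nonneg_left h3 hr0.le
    rw [hD]
    nlinarith
  have hR : 2 / (A * (y ^ 2)⁻¹) + 1 + r * (2 * I + k) ≤ (2 / A + D) * x ^ (2 - α) := by
    have h3 : 2 / (A * (y ^ 2)⁻¹) = 2 / A * y ^ 2 := by field_simp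
    have h4 : D * y ≤ D * y ^ 2 := by
      gcongr
      nlinarith
    rw [h3, hyy]
    linarith
  have hxx : (2 / A + D) * x ^ (2 - α) ≤ x := by
    calc (2 / A + D) * x ^ (2 - α) ≤ x ^ (α - 1) * x ^ (2 - α) := by gcongr
      _ = x := by
        rw [← Real.rpow_add hx0]
        convert Real.rpow_one x using 2
        ring
  obtain ⟨n, hn1, hn2, hn3⟩ := exists_isAP_of_large (I := I) hα₁ hα₂ hk hr hx
    (B := A * (y ^ 2)⁻¹) (by rw [hyi, hA]) rfl (hR.trans hxx)
    (by
      calc (2 : ℝ) ≤ A * r * K ^ 2 := hKA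
        _ = A * (y ^ 2)⁻¹ * r * (K * y) ^ 2 := by field_simp
        _ ≤ _ := by gcongr)
    (by
      calc A * (y ^ 2)⁻¹ * (1 + r * (2 * I + k)) ≤ A * (y ^ 2)⁻¹ * (D * y) := by gcongr
        _ = A * D / y := by field_simp
        _ ≤ 1 / k := by
          rw [div_le_div_iff₀ hy0 hk0]
          linarith)
  exact ⟨n, hn1, by linarith, hn3⟩

/-- `minLength` is attained as soon as some integer `n ≥ x` starts a progression. -/
theorem isLeast_minLength {α x : ℝ} {k r : ℕ}
    (h : ∃ n : ℤ, x ≤ n ∧ IsAP k (fun j => ⌊((n : ℝ) + (r : ℝ) * (j : ℝ)) ^ α⌋)) :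
    IsLeast (lengthSet α k r x) (minLength α k r x) := by
  obtain ⟨n, ⟨hn1, hn2⟩, hmin⟩ := Int.exists_least_of_bdd
    (P := fun n : ℤ => x ≤ n ∧ IsAP k (fun j => ⌊((n : ℝ) + (r : ℝ) * (j : ℝ)) ^ α⌋))
    ⟨⌈x⌉, fun z hz => Int.ceil_le.mpr hz.1⟩ h
  have hl : IsLeast (lengthSet α k r x) ((n : ℝ) - x) := by
    refine ⟨⟨by linarith, n, hn1, by linarith, hn2⟩, ?_⟩
    rintro y ⟨-, z, hz1, hz2, hz3⟩
    have : (n : ℝ) ≤ z := by exact_mod_cast hmin z ⟨hz1, hz3⟩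
    linarith
  rw [minLength, hl.csInf_eq]
  exact hl

theorem theorem6 (α : ℝ) (hα₁ : 1 < α) (hα₂ : α < 2) (k : ℕ) (hk : 3 ≤ k) (r : ℕ) (hr : 1 ≤ r) :
    (∀ x : ℝ, 1 ≤ x → IsLeast (lengthSet α k r x) (minLength α k r x)) ∧
      (fun x : ℝ => minLength α k r x) =O[atTop] (fun x : ℝ => x ^ (2 - α)) := by
  obtain ⟨C, hC⟩ := exists_isAP_short_interval hα₁ hα₂ (k := k) (by omega) hr
  -- A progression found beyond a larger `z` also serves `x`, so no largeness of `x` is needed.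
  have hleast : ∀ x : ℝ, IsLeast (lengthSet α k r x) (minLength α k r x) := by
    intro x
    obtain ⟨z, ⟨n, hn, -, hAP⟩, hz⟩ := (hC.and (eventually_ge_atTop x)).exists
    exact isLeast_minLength ⟨n, hz.trans hn, hAP⟩
  refine ⟨fun x _ => hleast x, Asymptotics.IsBigO.of_bound C ?_⟩
  filter_upwards [hC, eventually_ge_atTop 1] with x ⟨n, hn1, hn2, hAP⟩ hx
  have h0 : 0 ≤ minLength α k r x := (hleast x).1.1
  have h1 : minLength α k r x ≤ n - x :=
    (hleast x).2 ⟨by linarith, n, hn1, by linarith, hAP⟩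
  rw [Real.norm_of_nonneg h0, Real.norm_of_nonneg (by positivity)]
  linarith
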